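/- Let $A\in\mathbb{R}^{n\times n}$, $\bar B\in\mathbb{R}^{n\times q}$, $C\in\mathbb{R}^{p\times n}$, $\mathscr{X}=\mathbb{R}^n$, $\mathscr{Y}=\mathbb{R}^p$, and let $\mathbb{C}=\mathbb{C}_g\cup\mathbb{C}_b$, $\mathbb{C}_g\cap\mathbb{C}_b=\varnothing$, be a partition into "good" and "bad" parts, each closed under complex conjugation (for instance $\mathbb{C}_g=\{\operatorname{Re}\lambda<0\}$). A subspace $\mathscr{W}\subseteq\mathscr{X}$ is $(C,A)$-invariant if $(A+LC)\mathscr{W}\subseteq\mathscr{W}$ for some linear $L:\mathscr{Y}\to\mathscr{X}$; write $\mathbf{L}(\mathscr{W})$ for the set of such $L$. For a subspace $\mathscr{K}$ put $\langle\mathscr{K}\,|\,A\rangle=\mathscr{K}\cap A^{-1}\mathscr{K}\cap\dots\cap A^{-(n-1)}\mathscr{K}$. A subspace $\mathscr{S}$ is an unobservability subspace if $\mathscr{S}=\langle\operatorname{Ker}HC\,|\,A+LC\rangle$ for some linear $L:\mathscr{Y}\to\mathscr{X}$ and $H:\mathscr{Y}\to\mathscr{Y}$. Let $\mathscr{W}^*$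 and $\mathscr{S}^*$ be the smallest $(C,A)$-invariant subspace and the smallest unobservability subspace containing $\operatorname{Im}\bar B$; they exist, and $\mathscr{W}^*\subseteq\mathscr{S}^*$. For any $L\in\mathbf{L}(\mathscr{W}^*)$ the map $A_L=A+LC$ leaves $\mathscr{W}^*$ and $\mathscr{S}^*$ invariant, and the induced map $A_L|\mathscr{S}^*/\mathscr{W}^*$ does not depend on $L$. Factor its minimal polynomial over $\mathbb{R}$ as $\beta=\beta_g\beta_b$, where the complex zeros of $\beta_g$ lie in $\mathbb{C}_g$ and those of $\beta_b$ in $\mathbb{C}_b$. Put $$\bar{\mathscr{X}}_b^*=\operatorname{Ker}\beta_b(A_L|\mathscr{S}^*/\mathscr{W}^*)\subseteq\mathscr{S}^*/\mathscr{W}^*,\qquad \mathscr{W}_g^*=P^{-1}\bar{\mathscr{X}}_b^*,$$ where $P:\mathscr{X}\to\mathscr{X}/\mathscr{W}^*$ is the canonical projection. Let $(C\bar B)^\dagger$ be the Moore–Penrose pseudoinverse of $C\bar B$, and call a pair $(C,F)$, $F\in\mathbb{R}^{n\times n}$, detectable if all eigenvalues of the restriction of $F$ to its unobservable subspace $\langle\operatorname{Ker}C\,|\,F\rangle$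 lie in $\mathbb{C}_g$. Then the two conditions (i) $\operatorname{rank}(C\bar B)=\operatorname{rank}(\bar B)$ and (ii) $(C,A_1)$ is detectable, where $A_1=\bigl(I_n-\bar B(C\bar B)^\dagger C\bigr)A$, hold together if and only if $\mathscr{W}_g^*\cap\operatorname{Ker}C=0$. -/

import Mathlib

namespace UnknownInput

open Module Polynomial

section Geometric

variable {X Y : Type*} [AddCommGroup X] [Module ℝ X] [AddCommGroup Y] [Module ℝ Y]

/-- `A_L = A + L C`, where `L` is an output injection. -/
def inj (C : X →ₗ[ℝ] Y) (A : X →ₗ[ℝ] X) (L : Y →ₗ[ℝ] X) : X →ₗ[ℝ] X := A + L ∘ₗ C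

/-- `𝐋(W)`: the output injections `L` with `(A + L C) W ⊆ W`. -/
def friends (C : X →ₗ[ℝ] Y) (A : X →ₗ[ℝ] X) (W : Submodule ℝ X) : Set (Y →ₗ[ℝ] X) :=
  {L | W.map (inj C A L) ≤ W}

/-- `W` is `(C, A)`-invariant. -/
def IsCAInvariant (C : X →ₗ[ℝ] Y) (A : X →ₗ[ℝ] X) (W : Submodule ℝ X) : Prop :=
  ∃ L : Y →ₗ[ℝ] X, W.map (inj C A L) ≤ W

/-- The `(C, A)`-invariant subspaces containing `B`. -/
def caFamily (C : X →ₗ[ℝ] Y) (A : X →ₗ[ℝ] X) (B : Submodule ℝ X) : Set (Submodule ℝ X) :=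
  {W | IsCAInvariant C A W ∧ B ≤ W}

/-- `W*(C, A; B)`, the infimal `(C, A)`-invariant subspace containing `B`. -/
def wStar (C : X →ₗ[ℝ] Y) (A : X →ₗ[ℝ] X) (B : Submodule ℝ X) : Submodule ℝ X :=
  sInf (caFamily C A B)

/-- `⟨K | A⟩ = K ∩ A⁻¹ K ∩ ⋯ ∩ A^{-(n-1)} K`, where `n = dim X`. -/
noncomputable def unobs (K : Submodule ℝ X) (A : X →ₗ[ℝ] X) : Submodule ℝ X :=
  ⨅ i : Fin (finrank ℝ X), K.comap (A ^ (i : ℕ))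

/-- `S` is an unobservability subspace: `S = ⟨Ker H C | A + L C⟩` for some output injection `L`
and some measurement mixing `H`. -/
def IsUnobservabilitySubspace (C : X →ₗ[ℝ] Y) (A : X →ₗ[ℝ] X) (S : Submodule ℝ X) : Prop :=
  ∃ (L : Y →ₗ[ℝ] X) (H : Y →ₗ[ℝ] Y), S = unobs (LinearMap.ker (H ∘ₗ C)) (inj C A L)

/-- The unobservability subspaces containing `B`. -/
def unobsFamily (C : X →ₗ[ℝ] Y) (A : X →ₗ[ℝ] X) (B : Submodule ℝ X) : Set (Submodule ℝ X) :=
  {S | IsUnobservabilitySubspace C A S ∧ B ≤ S}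

/-- `S*(C, A; B)`, the infimal unobservability subspace containing `B`. -/
noncomputable def sStar (C : X →ₗ[ℝ] Y) (A : X →ₗ[ℝ] X) (B : Submodule ℝ X) : Submodule ℝ X :=
  sInf (unobsFamily C A B)

theorem isCAInvariant_iff (C : X →ₗ[ℝ] Y) (A : X →ₗ[ℝ] X) (W : Submodule ℝ X) :
    IsCAInvariant C A W ↔ ∀ x ∈ W, C x = 0 → A x ∈ W := by
  constructor
  · rintro ⟨L, hL⟩ x hx hC
    have := hL (Submodule.mem_map_of_mem hx)
    simpa [inj, hC] using this
  · intro h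
    -- a linear section of `C` restricted to `W`, extended to `Y`
    let D : W →ₗ[ℝ] Y := C ∘ₗ W.subtype
    obtain ⟨g, hg⟩ := D.rangeRestrict.exists_rightInverse_of_surjective D.range_rangeRestrict
    obtain ⟨G, hG⟩ := LinearMap.exists_extend (W.subtype ∘ₗ g)
    refine ⟨-(A ∘ₗ G), ?_⟩
    rintro _ ⟨x, hx, rfl⟩
    let d := D.rangeRestrict ⟨x, hx⟩
    have h1 : G (C x) = ((g d : W) : X) := LinearMap.congr_fun hG d
    have h2 : C ((g d : W) : X) = C x := by
      have := LinearMap.congr_fun hg d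
      exact congrArg Subtype.val this
    have h3 : A (x - ((g d : W) : X)) ∈ W :=
      h _ (W.sub_mem hx (g d).2) (by simp [h2])
    simpa [inj, h1, sub_eq_add_neg] using h3

/-- The infimum `W*` belongs to the family. -/
theorem wStar_isLeast (C : X →ₗ[ℝ] Y) (A : X →ₗ[ℝ] X) (B : Submodule ℝ X) :
    IsLeast (caFamily C A B) (wStar C A B) := by
  refine ⟨⟨?_, le_sInf fun W hW => hW.2⟩, fun W hW => sInf_le hW⟩
  rw [isCAInvariant_iff]
  intro x hx hC
  simp only [wStar, Submodule.mem_sInf] at hx ⊢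
  exact fun W hW => (isCAInvariant_iff C A W).1 hW.1 x (hx W hW) hC

theorem friends_wStar_nonempty (C : X →ₗ[ℝ] Y) (A : X →ₗ[ℝ] X) (B : Submodule ℝ X) :
    (friends C A (wStar C A B)).Nonempty :=
  (wStar_isLeast C A B).1.1

theorem unobs_le [FiniteDimensional ℝ X] (K : Submodule ℝ X) (A : X →ₗ[ℝ] X) :
    unobs K A ≤ K := by
  intro x hx
  rcases subsingleton_or_nontrivial X with h | h
  · rw [Subsingleton.elim x 0]; exact K.zero_mem
  · have := (Submodule.mem_iInf _).1 hx ⟨0, finrank_pos⟩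
    simpa using this

theorem le_unobs {K V : Submodule ℝ X} {A : X →ₗ[ℝ] X} (hK : V ≤ K) (hA : ∀ x ∈ V, A x ∈ V) :
    V ≤ unobs K A := by
  have key : ∀ (k : ℕ), ∀ x ∈ V, (A ^ k) x ∈ V := by
    intro k
    induction k with
    | zero => intro x hx; simpa using hx
    | succ k ih => intro x hx; rw [pow_succ]; exact ih _ (hA x hx)
  exact fun x hx => (Submodule.mem_iInf _).2 fun i => hK (key i x hx)

/-- `⟨K | A⟩` is `A`-invariant. -/
theorem map_mem_unobs [FiniteDimensional ℝ X] (K : Submodule ℝ X) (A : X →ₗ[ℝ] X) :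
    ∀ x ∈ unobs K A, A x ∈ unobs K A := by
  intro x hx
  have hlt : ∀ k < finrank ℝ X, (A ^ k) x ∈ K := fun k hk =>
    (Submodule.mem_iInf _).1 hx ⟨k, hk⟩
  have hn : (A ^ finrank ℝ X) x ∈ K := by
    have h0 : aeval A A.charpoly x = 0 := by rw [LinearMap.aeval_self_charpoly]; rfl
    rw [aeval_eq_sum_range, LinearMap.charpoly_natDegree, Finset.sum_range_succ] at h0
    have h1 : A.charpoly.coeff (finrank ℝ X) = 1 := by
      have := A.charpoly_monic.coeff_natDegree
      rwa [LinearMap.charpoly_natDegree] at this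
    rw [h1, one_smul, LinearMap.add_apply, add_comm] at h0
    rw [eq_neg_of_add_eq_zero_left h0, LinearMap.sum_apply]
    exact K.neg_mem (K.sum_mem fun i hi => K.smul_mem _ (hlt i (Finset.mem_range.1 hi)))
  refine (Submodule.mem_iInf _).2 fun i => ?_
  change (A ^ (i : ℕ)) (A x) ∈ K
  have : (A ^ (i : ℕ)) (A x) = (A ^ ((i : ℕ) + 1)) x := by rw [pow_succ]; rfl
  rw [this]
  rcases Nat.lt_or_ge ((i : ℕ) + 1) (finrank ℝ X) with h | h
  · exact hlt _ h
  · rwa [le_antisymm i.2 h]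

theorem sStar_isCAInvariant [FiniteDimensional ℝ X] (C : X →ₗ[ℝ] Y) (A : X →ₗ[ℝ] X)
    (B : Submodule ℝ X) : ∀ x ∈ sStar C A B, C x = 0 → A x ∈ sStar C A B := by
  intro x hx hC
  simp only [sStar, Submodule.mem_sInf] at hx ⊢
  intro S hS
  obtain ⟨L, H, hLH⟩ := hS.1
  have := map_mem_unobs _ (inj C A L) x (hLH ▸ hx S hS)
  rw [← hLH] at this
  simpa [inj, hC] using this

theorem wStar_le_sStar [FiniteDimensional ℝ X] (C : X →ₗ[ℝ] Y) (A : X →ₗ[ℝ] X)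
    (B : Submodule ℝ X) : wStar C A B ≤ sStar C A B :=
  (wStar_isLeast C A B).2
    ⟨(isCAInvariant_iff C A _).2 (sStar_isCAInvariant C A B), le_sInf fun _ hS => hS.2⟩

/-- Every `L ∈ 𝐋(W*)` gives an unobservability subspace containing `B`, namely
`⟨W* + Ker C | A + L C⟩`. -/
theorem unobs_mem_unobsFamily [FiniteDimensional ℝ X] (C : X →ₗ[ℝ] Y) (A : X →ₗ[ℝ] X)
    (B : Submodule ℝ X) {L : Y →ₗ[ℝ] X} (hL : L ∈ friends C A (wStar C A B)) :
    unobs (wStar C A B ⊔ LinearMap.ker C) (inj C A L) ∈ unobsFamily C A B := by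
  refine ⟨?_, (wStar_isLeast C A B).1.2.trans
    (le_unobs le_sup_left fun x hx => hL (Submodule.mem_map_of_mem hx))⟩
  obtain ⟨Q, hQ⟩ := ((wStar C A B).map C).exists_isCompl
  refine ⟨L, Q.projection _ hQ.symm, ?_⟩
  rw [LinearMap.ker_comp, Submodule.ker_projection, Submodule.comap_map_eq]

theorem sStar_le [FiniteDimensional ℝ X] (C : X →ₗ[ℝ] Y) (A : X →ₗ[ℝ] X)
    (B : Submodule ℝ X) : sStar C A B ≤ wStar C A B ⊔ LinearMap.ker C := by
  obtain ⟨L, hL⟩ := friends_wStar_nonempty C A B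
  exact (sInf_le (unobs_mem_unobsFamily C A B hL)).trans (unobs_le _ _)

/-- The infimum `S*` belongs to the family. -/
theorem sStar_isLeast [FiniteDimensional ℝ X] (C : X →ₗ[ℝ] Y) (A : X →ₗ[ℝ] X)
    (B : Submodule ℝ X) : IsLeast (unobsFamily C A B) (sStar C A B) := by
  obtain ⟨L, hL⟩ := friends_wStar_nonempty C A B
  set U := unobs (wStar C A B ⊔ LinearMap.ker C) (inj C A L) with hU
  have hUmem : U ∈ unobsFamily C A B := unobs_mem_unobsFamily C A B hL
  have hWU : wStar C A B ≤ U :=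
    le_unobs le_sup_left fun x hx => hL (Submodule.mem_map_of_mem hx)
  have hle : ∀ T ∈ unobsFamily C A B, U ≤ T := by
    intro T hT
    have hWT : wStar C A B ≤ T := (wStar_le_sStar C A B).trans (sInf_le hT)
    obtain ⟨⟨M, H, hMH⟩, hBT⟩ := hT
    have hTinv : ∀ x ∈ T, inj C A M x ∈ T := by
      rw [hMH]; exact map_mem_unobs _ _
    have hTK : T ≤ LinearMap.ker (H ∘ₗ C) := by rw [hMH]; exact unobs_le _ _
    have hUK : U ≤ LinearMap.ker (H ∘ₗ C) :=
      (unobs_le _ _).trans (sup_le (hWT.trans hTK) (LinearMap.ker_le_ker_comp C H))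
    have : U ⊔ T ≤ T := by
      conv_rhs => rw [hMH]
      refine le_unobs (sup_le hUK hTK) fun x hx => ?_
      obtain ⟨u, hu, t, ht, rfl⟩ := Submodule.mem_sup.1 hx
      rw [map_add]
      refine Submodule.add_mem _ ?_ (Submodule.mem_sup_right (hTinv t ht))
      obtain ⟨w, hw, k, hk, rfl⟩ := Submodule.mem_sup.1 (unobs_le _ _ hu)
      have hk' : k ∈ U := (Submodule.add_mem_iff_right U (hWU hw)).1 hu
      rw [map_add]
      refine Submodule.add_mem _ (Submodule.mem_sup_right (hTinv w (hWT hw)))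
        (Submodule.mem_sup_left ?_)
      have h1 : inj C A L k ∈ U := map_mem_unobs _ _ k hk'
      have hk0 : C k = 0 := hk
      simpa [inj, hk0] using h1
    exact le_sup_left.trans this
  have : sStar C A B = U := le_antisymm (sInf_le hUmem) (le_sInf hle)
  rw [this]
  exact ⟨hUmem, hle⟩

/-- `L ∈ 𝐋(W*)` also leaves `S*` invariant. -/
theorem friends_sStar [FiniteDimensional ℝ X] (C : X →ₗ[ℝ] Y) (A : X →ₗ[ℝ] X)
    (B : Submodule ℝ X) {L : Y →ₗ[ℝ] X} (hL : L ∈ friends C A (wStar C A B)) :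
    ∀ x ∈ sStar C A B, inj C A L x ∈ sStar C A B := by
  intro x hx
  obtain ⟨w, hw, k, hk, rfl⟩ := Submodule.mem_sup.1 (sStar_le C A B hx)
  have hk' : k ∈ sStar C A B :=
    (Submodule.add_mem_iff_right _ (wStar_le_sStar C A B hw)).1 hx
  have hk0 : C k = 0 := hk
  rw [map_add]
  refine Submodule.add_mem _ (wStar_le_sStar C A B (hL (Submodule.mem_map_of_mem hw))) ?_
  simpa [inj, hk0] using sStar_isCAInvariant C A B k hk' hk0

/-- The map `A_L | X / W*` induced by `A_L` on the quotient space `X / W*`. -/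
def quotMap (C : X →ₗ[ℝ] Y) (A : X →ₗ[ℝ] X) (B : Submodule ℝ X) (L : Y →ₗ[ℝ] X)
    (hL : L ∈ friends C A (wStar C A B)) :
    (X ⧸ wStar C A B) →ₗ[ℝ] (X ⧸ wStar C A B) :=
  (wStar C A B).mapQ (wStar C A B) (inj C A L) (Submodule.map_le_iff_le_comap.1 hL)

/-- `S* / W*`, as a subspace of `X / W*`. -/
noncomputable def zeroSpace (C : X →ₗ[ℝ] Y) (A : X →ₗ[ℝ] X) (B : Submodule ℝ X) :
    Submodule ℝ (X ⧸ wStar C A B) :=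
  (sStar C A B).map (wStar C A B).mkQ

theorem quotMap_mem_zeroSpace [FiniteDimensional ℝ X] (C : X →ₗ[ℝ] Y) (A : X →ₗ[ℝ] X)
    (B : Submodule ℝ X) (L : Y →ₗ[ℝ] X) (hL : L ∈ friends C A (wStar C A B)) :
    ∀ v ∈ zeroSpace C A B, quotMap C A B L hL v ∈ zeroSpace C A B := by
  rintro _ ⟨x, hx, rfl⟩
  exact ⟨inj C A L x, friends_sStar C A B hL x hx, rfl⟩

/-- The map `A_L | S* / W*`. -/
noncomputable def zeroMap [FiniteDimensional ℝ X] (C : X →ₗ[ℝ] Y) (A : X →ₗ[ℝ] X)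
    (B : Submodule ℝ X) (L : Y →ₗ[ℝ] X) (hL : L ∈ friends C A (wStar C A B)) :
    zeroSpace C A B →ₗ[ℝ] zeroSpace C A B :=
  (quotMap C A B L hL).restrict (quotMap_mem_zeroSpace C A B L hL)

/-- `X̄_b* = (S* / W*) ∩ Ker β_b(A_L | S* / W*)`, as a subspace of `X / W*`. -/
noncomputable def badSpace [FiniteDimensional ℝ X] (C : X →ₗ[ℝ] Y) (A : X →ₗ[ℝ] X)
    (B : Submodule ℝ X) (L : Y →ₗ[ℝ] X) (hL : L ∈ friends C A (wStar C A B))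
    (βb : Polynomial ℝ) :
    Submodule ℝ (X ⧸ wStar C A B) :=
  (LinearMap.ker (aeval (zeroMap C A B L hL) βb)).map (zeroSpace C A B).subtype

/-- `W_g* = P⁻¹ X̄_b*`, where `P : X → X / W*` is the canonical projection. -/
noncomputable def wgStar [FiniteDimensional ℝ X] (C : X →ₗ[ℝ] Y) (A : X →ₗ[ℝ] X)
    (B : Submodule ℝ X) (L : Y →ₗ[ℝ] X) (hL : L ∈ friends C A (wStar C A B))
    (βb : Polynomial ℝ) :
    Submodule ℝ X :=
  (badSpace C A B L hL βb).comap (wStar C A B).mkQ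

/-- `(C, A)` is detectable with respect to the good region `Cg`: the map that `A` induces on the
unobservable subspace `⟨Ker C | A⟩` has all its (complex) eigenvalues in `Cg`. -/
def IsDetectable [FiniteDimensional ℝ X] (Cg : Set ℂ) (C : X →ₗ[ℝ] Y) (A : X →ₗ[ℝ] X) : Prop :=
  ∀ z : ℂ, aeval z (A.restrict (map_mem_unobs (LinearMap.ker C) A)).charpoly = 0 → z ∈ Cg

/-- The map `A_L | S* / W*` does not depend on the choice of `L ∈ 𝐋(W*)`. -/
theorem zeroMap_eq [FiniteDimensional ℝ X] (C : X →ₗ[ℝ] Y) (A : X →ₗ[ℝ] X)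
    (B : Submodule ℝ X) (L M : Y →ₗ[ℝ] X) (hL : L ∈ friends C A (wStar C A B))
    (hM : M ∈ friends C A (wStar C A B)) : zeroMap C A B L hL = zeroMap C A B M hM := by
  apply LinearMap.ext
  rintro ⟨_, x, hx, rfl⟩
  apply Subtype.ext
  change (wStar C A B).mkQ (inj C A L x) = (wStar C A B).mkQ (inj C A M x)
  obtain ⟨w, hw, k, hk, rfl⟩ := Submodule.mem_sup.1 (sStar_le C A B hx)
  have hk0 : C k = 0 := hk
  rw [← sub_eq_zero, ← map_sub, ← LinearMap.mem_ker, Submodule.ker_mkQ]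
  have := Submodule.sub_mem _ (hL (Submodule.mem_map_of_mem hw))
    (hM (Submodule.mem_map_of_mem hw))
  simpa [inj, hk0] using this

end Geometric

/-- A symmetric partition `ℂ = Cg ∪ Cb`, `Cg ∩ Cb = ∅`. -/
structure IsSymmetricPartition (Cg Cb : Set ℂ) : Prop where
  union : Cg ∪ Cb = Set.univ
  inter : Cg ∩ Cb = ∅
  conj_good : ∀ z ∈ Cg, (starRingEnd ℂ) z ∈ Cg
  conj_bad : ∀ z ∈ Cb, (starRingEnd ℂ) z ∈ Cb

/-- `β = β_g β_b`, with the complex zeros of `β_g` in `Cg` and those of `β_b` in `Cb`. -/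
structure IsGoodBadFactorization (Cg Cb : Set ℂ) (β βg βb : Polynomial ℝ) : Prop where
  mul_eq : βg * βb = β
  good : ∀ z : ℂ, aeval z βg = 0 → z ∈ Cg
  bad : ∀ z : ℂ, aeval z βb = 0 → z ∈ Cb

/-- Every nonzero real polynomial has such a factorization. -/
theorem exists_goodBadFactorization {Cg Cb : Set ℂ} (h : IsSymmetricPartition Cg Cb)
    (β : ℝ[X]) (hβ : β ≠ 0) : ∃ βg βb, IsGoodBadFactorization Cg Cb β βg βb := by
  have hcov : ∀ z : ℂ, z ∈ Cg ∨ z ∈ Cb := fun z => by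
    have : z ∈ Cg ∪ Cb := h.union ▸ Set.mem_univ z
    exact this
  induction β using WfDvdMonoid.induction_on_irreducible with
  | zero => exact absurd rfl hβ
  | unit u hu =>
    refine ⟨u, 1, by simp, fun z hz => ?_, fun z hz => by simp at hz⟩
    exact absurd hz (hu.map (aeval z)).ne_zero
  | mul a p ha hp ih =>
    obtain ⟨g, b, hgb⟩ := ih ha
    have hroots : ∀ z w : ℂ, aeval z p = 0 → aeval w p = 0 → w = z ∨ w = (starRingEnd ℂ) z := by
      intro z w hz hw
      -- the real polynomial with zeros `z` and `z̄` is divisible by `p`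
      have key : ∀ u : ℂ, aeval u (X ^ 2 - C (2 * z.re) * X + C (Complex.normSq z) : ℝ[X]) =
          (u - z) * (u - (starRingEnd ℂ) z) := by
        intro u
        have h1 : z + (starRingEnd ℂ) z = ((2 : ℝ) : ℂ) * (z.re : ℂ) := by
          rw [Complex.add_conj, Complex.ofReal_mul]
        have h2 := Complex.mul_conj z
        simp only [map_add, map_sub, map_mul, map_pow, aeval_X, aeval_C, Complex.coe_algebraMap]
        rw [← h1, ← h2]
        ring
      have hd : p ∣ (X ^ 2 - C (2 * z.re) * X + C (Complex.normSq z) : ℝ[X]) :=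
        (hp.dvd_iff_aeval_eq_zero hz).1 (by rw [key]; simp)
      have h0 := (key w).symm.trans (aeval_eq_zero_of_dvd_aeval_eq_zero hd hw)
      rcases mul_eq_zero.1 h0 with h0 | h0
      · exact Or.inl (sub_eq_zero.1 h0)
      · exact Or.inr (sub_eq_zero.1 h0)
    obtain ⟨z, hz⟩ := IsAlgClosed.exists_aeval_eq_zero ℂ p hp.degree_pos.ne'
    rcases hcov z with hzg | hzb
    · refine ⟨p * g, b, ?_, fun w hw => ?_, hgb.bad⟩
      · rw [mul_assoc, hgb.mul_eq]
      · rw [map_mul, mul_eq_zero] at hw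
        rcases hw with hw | hw
        · rcases hroots z w hz hw with rfl | rfl
          · exact hzg
          · exact h.conj_good z hzg
        · exact hgb.good w hw
    · refine ⟨g, p * b, ?_, hgb.good, fun w hw => ?_⟩
      · rw [mul_left_comm, hgb.mul_eq]
      · rw [map_mul, mul_eq_zero] at hw
        rcases hw with hw | hw
        · rcases hroots z w hz hw with rfl | rfl
          · exact hzb
          · exact h.conj_bad z hzb
        · exact hgb.bad w hw

section Pseudoinverse

open Matrix

variable {m n : Type*} [Fintype m] [Fintype n]

/-- The Penrose equations: `G` is the Moore–Penrose pseudoinverse of `M`. -/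
structure IsPinv (M : Matrix m n ℝ) (G : Matrix n m ℝ) : Prop where
  mul_mul_left : M * G * M = M
  mul_mul_right : G * M * G = G
  symm_left : (M * G)ᵀ = M * G
  symm_right : (G * M)ᵀ = G * M

theorem exists_isPinv (M : Matrix m n ℝ) : ∃ G, IsPinv M G := by
  classical
  have hS : (Mᴴ * M).IsHermitian := isHermitian_conjTranspose_mul_self M
  obtain ⟨P, hP, h1, h2, h3⟩ : ∃ P : Matrix n n ℝ, Pᴴ = P ∧
      (Mᴴ * M) * P * (Mᴴ * M) = Mᴴ * M ∧ P * (Mᴴ * M) * P = P ∧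
      (P * (Mᴴ * M))ᴴ = P * (Mᴴ * M) := by
    have hinv : ∀ a : ℝ, a⁻¹ * a * a⁻¹ = a⁻¹ := fun a => by
      by_cases h : a = 0 <;> simp [h]
    rw [hS.spectral_theorem]
    refine ⟨Unitary.conjStarAlgAut ℝ _ hS.eigenvectorUnitary
      (diagonal fun i => (hS.eigenvalues i)⁻¹), ?_, ?_, ?_, ?_⟩
    · rw [← star_eq_conjTranspose, ← map_star, star_eq_conjTranspose, diagonal_conjTranspose]
      rfl
    · rw [← map_mul, ← map_mul, diagonal_mul_diagonal, diagonal_mul_diagonal]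
      congr 2; ext i; simp
    · rw [← map_mul, ← map_mul, diagonal_mul_diagonal, diagonal_mul_diagonal]
      congr 2; ext i; exact hinv (hS.eigenvalues i)
    · rw [← map_mul, ← star_eq_conjTranspose, ← map_star, star_eq_conjTranspose,
        diagonal_mul_diagonal, diagonal_conjTranspose]
      rfl
  refine ⟨P * Mᴴ, ?_, ?_, ?_, ?_⟩
  · have h0 : Mᴴ * M * (P * (Mᴴ * M) - 1) = 0 := by
      rw [mul_sub, ← mul_assoc, h1, mul_one, sub_self]
    rw [conjTranspose_mul_self_mul_eq_zero, Matrix.mul_sub, Matrix.mul_one, sub_eq_zero] at h0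
    simpa only [Matrix.mul_assoc] using h0
  · calc P * Mᴴ * M * (P * Mᴴ) = (P * (Mᴴ * M) * P) * Mᴴ := by simp only [Matrix.mul_assoc]
      _ = P * Mᴴ := by rw [h2]
  · rw [← conjTranspose_eq_transpose_of_trivial]
    simp only [conjTranspose_mul, conjTranspose_conjTranspose, hP, Matrix.mul_assoc]
  · rw [← conjTranspose_eq_transpose_of_trivial, Matrix.mul_assoc]
    exact h3

theorem IsPinv.unique {M : Matrix m n ℝ} {G H : Matrix n m ℝ} (hG : IsPinv M G)
    (hH : IsPinv M H) : G = H := by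
  have e1 : M * G = M * H := by
    calc M * G = (M * H * M) * G := by rw [hH.mul_mul_left]
      _ = (M * H)ᵀ * (M * G)ᵀ := by rw [hH.symm_left, hG.symm_left]; simp only [Matrix.mul_assoc]
      _ = ((M * G * M) * H)ᵀ := by rw [← transpose_mul]; simp only [Matrix.mul_assoc]
      _ = M * H := by rw [hG.mul_mul_left, hH.symm_left]
  have e2 : G * M = H * M := by
    calc G * M = G * (M * H * M) := by rw [hH.mul_mul_left]
      _ = (G * M)ᵀ * (H * M)ᵀ := by rw [hG.symm_right, hH.symm_right]; simp only [Matrix.mul_assoc]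
      _ = (H * (M * G * M))ᵀ := by rw [← transpose_mul]; simp only [Matrix.mul_assoc]
      _ = H * M := by rw [hG.mul_mul_left, hH.symm_right]
  calc G = G * M * G := hG.mul_mul_right.symm
    _ = H * M * H := by rw [e2, Matrix.mul_assoc, e1, ← Matrix.mul_assoc]
    _ = H := hH.mul_mul_right

/-- The Moore–Penrose pseudoinverse `M†`. -/
noncomputable def pinv (M : Matrix m n ℝ) : Matrix n m ℝ := (exists_isPinv M).choose

theorem pinv_spec (M : Matrix m n ℝ) : IsPinv M (pinv M) := (exists_isPinv M).choose_spec

end Pseudoinverse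

end UnknownInput

/-! Condition (i) says that Im B̄ meets Ker C only in 0 (`rank_mul_eq_rank_right_iff_disjoint`).
Since Im B̄ ⊆ W* ⊆ W_g*, it is forced by W_g* ∩ Ker C = 0, so it suffices to compare the latter with
detectability when (i) holds. Then W* = Im B̄ (`wStar_eq_self`), and S* ⊆ W* + Ker C gives S* = W* ⊕
(S* ∩ Ker C); hence S* ∩ Ker C ≅ S*/W* (`zeroEquiv`). The map A₁ differs from A by values in Im B̄,
and C A₁ vanishes wherever A lands in Im B̄ + Ker C. Consequently S* ∩ Ker C is the unobservable
subspace of (C, A₁) (`unobs_eq_sStar_inf_ker`), and A₁ acts on it as A_L acts on S*/W*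
(`charpoly_restrict_unobs_eq`). Detectability thus says that A_L | S*/W* has only good eigenvalues,
that is Ker β_b = 0 (`ker_aeval_bad_eq_bot_iff`), which the same isomorphism turns into W_g* ∩ Ker C
= 0. -/

namespace UnknownInput

open Module Polynomial

/-! ### Good and bad eigenvalues of a real endomorphism -/

section Spectrum

variable {V : Type*} [AddCommGroup V] [Module ℝ V] [FiniteDimensional ℝ V]

/-- A complex zero of the characteristic polynomial is a zero of every annihilating polynomial. -/
theorem aeval_eq_zero_of_charpoly {f : V →ₗ[ℝ] V} {r : ℝ[X]} (hr : aeval f r = 0) {z : ℂ}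
    (hz : aeval z f.charpoly = 0) : aeval z r = 0 := by
  have hroot : (f.baseChange ℂ).charpoly.IsRoot z := by
    rw [LinearMap.charpoly_baseChange, IsRoot, eval_map_algebraMap, hz]
  obtain ⟨v, hv⟩ := ((End.hasEigenvalue_iff_isRoot_charpoly _ z).2 hroot).exists_hasEigenvector
  -- The relation r(f) = 0 survives complexification; applied to an eigenvector for z it gives r(z)
  -- v = 0 with v ≠ 0.
  have h0 : aeval (f.baseChange ℂ) (r.map (algebraMap ℝ ℂ)) = 0 := by
    rw [aeval_map_algebraMap]
    have := aeval_algHom_apply (End.baseChangeHom ℝ ℂ V) f r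
    rw [hr, map_zero] at this
    exact this
  have h1 := End.aeval_apply_of_hasEigenvector (p := r.map (algebraMap ℝ ℂ)) hv
  rw [h0, LinearMap.zero_apply, eval_map_algebraMap] at h1
  exact (smul_eq_zero.1 h1.symm).resolve_right hv.2

/-- The bad modes vanish exactly when all eigenvalues are good. -/
theorem ker_aeval_bad_eq_bot_iff {Cg Cb : Set ℂ} (hpart : IsSymmetricPartition Cg Cb)
    {f : V →ₗ[ℝ] V} {βg βb : ℝ[X]} (hβ : IsGoodBadFactorization Cg Cb (minpoly ℝ f) βg βb) :
    LinearMap.ker (aeval f βb) = ⊥ ↔ ∀ z : ℂ, aeval z f.charpoly = 0 → z ∈ Cg := by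
  have hmul : aeval f (βb * βg) = 0 := by rw [mul_comm, hβ.mul_eq, minpoly.aeval]
  constructor
  · intro hker z hz
    -- As β_b(f) is injective and β_b(f) β_g(f) = 0, already β_g annihilates f, so every eigenvalue
    -- is a zero of β_g.
    refine hβ.good z (aeval_eq_zero_of_charpoly (f := f) ?_ hz)
    ext v
    have h : aeval f βb (aeval f βg v) = 0 := by
      rw [← End.mul_apply, ← map_mul, hmul, LinearMap.zero_apply]
    exact LinearMap.ker_eq_bot'.1 hker _ h
  · intro hgood
    have hβ0 : βb ≠ 0 := by
      rintro rfl
      exact minpoly.ne_zero (Algebra.IsIntegral.isIntegral (R := ℝ) f) (by rw [← hβ.mul_eq, mul_zero])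
    -- Otherwise β_b has a complex zero, which is bad; but β_b divides the characteristic
    -- polynomial, so that zero is an eigenvalue and good.
    have hdeg : βb.degree = 0 := by
      by_contra hd
      obtain ⟨z, hz⟩ := IsAlgClosed.exists_aeval_eq_zero ℂ βb hd
      have hdvd : βb ∣ f.charpoly :=
        (Dvd.intro_left βg hβ.mul_eq).trans (LinearMap.minpoly_dvd_charpoly f)
      have hmem : z ∈ Cg ∩ Cb :=
        ⟨hgood z (aeval_eq_zero_of_dvd_aeval_eq_zero hdvd hz), hβ.bad z hz⟩
      rw [hpart.inter] at hmem
      exact hmem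
    have hunit : IsUnit (aeval f βb) := (isUnit_iff_degree_eq_zero.2 hdeg).map (aeval f)
    exact LinearMap.ker_eq_bot.2 ((End.isUnit_iff _).1 hunit).injective

end Spectrum

/-! ### The unobservable subspace of (C, A₁) and S*/W* -/

section Geometric

variable {X Y : Type*} [AddCommGroup X] [Module ℝ X] [AddCommGroup Y] [Module ℝ Y]

/-- Invariance only constrains A on B ∩ Ker C, which is 0 here, so B itself is the least member of
its family. -/
theorem wStar_eq_self {C : X →ₗ[ℝ] Y} {A : X →ₗ[ℝ] X} {B : Submodule ℝ X}
    (h : Disjoint B (LinearMap.ker C)) : wStar C A B = B := by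
  refine le_antisymm ((wStar_isLeast C A B).2 ⟨(isCAInvariant_iff C A B).2 ?_, le_rfl⟩)
    (wStar_isLeast C A B).1.2
  intro x hx hC
  rw [Submodule.disjoint_def.1 h x hx hC, map_zero]
  exact B.zero_mem

variable [FiniteDimensional ℝ X]

theorem wStar_le_wgStar (C : X →ₗ[ℝ] Y) (A : X →ₗ[ℝ] X) (B : Submodule ℝ X) (L : Y →ₗ[ℝ] X)
    (hL : L ∈ friends C A (wStar C A B)) (βb : ℝ[X]) :
    wStar C A B ≤ wgStar C A B L hL βb := by
  intro x hx
  rw [wgStar, Submodule.mem_comap, Submodule.mkQ_apply, (Submodule.Quotient.mk_eq_zero _).2 hx]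
  exact Submodule.zero_mem _

theorem wgStar_le_sStar (C : X →ₗ[ℝ] Y) (A : X →ₗ[ℝ] X) (B : Submodule ℝ X) (L : Y →ₗ[ℝ] X)
    (hL : L ∈ friends C A (wStar C A B)) (βb : ℝ[X]) :
    wgStar C A B L hL βb ≤ sStar C A B := by
  rintro x ⟨v, -, hv⟩
  obtain ⟨s, hs, hsv⟩ := v.2
  have h : s - x ∈ wStar C A B := by
    rw [← (wStar C A B).ker_mkQ, LinearMap.mem_ker, map_sub, sub_eq_zero, hsv, ← hv]
    rfl
  exact (Submodule.sub_mem_iff_right _ hs).1 (wStar_le_sStar C A B h)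

theorem zeroSpace_mk_mem_badSpace_iff (C : X →ₗ[ℝ] Y) (A : X →ₗ[ℝ] X) (B : Submodule ℝ X)
    (L : Y →ₗ[ℝ] X) (hL : L ∈ friends C A (wStar C A B)) (βb : ℝ[X]) (v : zeroSpace C A B) :
    (v : X ⧸ wStar C A B) ∈ badSpace C A B L hL βb ↔
      v ∈ LinearMap.ker (aeval (zeroMap C A B L hL) βb) :=
  (Submodule.subtype_injective _).mem_set_image

/-- When `W*` meets `Ker C` trivially, `S* ∩ Ker C` is a complement of `W*` in `S*`. -/
noncomputable def zeroEquiv (C : X →ₗ[ℝ] Y) (A : X →ₗ[ℝ] X) (B : Submodule ℝ X)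
    (h : Disjoint (wStar C A B) (LinearMap.ker C)) :
    (sStar C A B ⊓ LinearMap.ker C : Submodule ℝ X) ≃ₗ[ℝ] zeroSpace C A B :=
  LinearEquiv.ofBijective
    ((wStar C A B).mkQ.restrict (p := sStar C A B ⊓ LinearMap.ker C) (q := zeroSpace C A B)
      fun _ hx => Submodule.mem_map_of_mem hx.1) <| by
    constructor
    · refine (injective_iff_map_eq_zero _).2 fun x hx => Subtype.ext ?_
      have hx' : (x : X) ∈ wStar C A B := by
        rw [← (wStar C A B).ker_mkQ]
        exact congrArg Subtype.val hx
      exact Submodule.disjoint_def.1 h x hx' x.2.2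
    · rintro ⟨_, s, hs, rfl⟩
      -- S* ⊆ W* + Ker C lets every class be represented in Ker C, and k = s - w stays in S*.
      obtain ⟨w, hw, k, hk, rfl⟩ := Submodule.mem_sup.1 (sStar_le C A B hs)
      have hk' : k ∈ sStar C A B :=
        (Submodule.add_mem_iff_right _ (wStar_le_sStar C A B hw)).1 hs
      refine ⟨⟨k, hk', hk⟩, Subtype.ext ?_⟩
      have hw0 : (wStar C A B).mkQ w = 0 := by simpa using hw
      change (wStar C A B).mkQ k = (wStar C A B).mkQ (w + k)
      rw [map_add, hw0, zero_add]

/-- Since W_g* ⊆ S*, all of W_g* ∩ Ker C lies in the domain of `zeroEquiv`, which carries it onto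
Ker β_b. -/
theorem wgStar_inf_ker_eq_bot_iff (C : X →ₗ[ℝ] Y) (A : X →ₗ[ℝ] X) (B : Submodule ℝ X)
    (L : Y →ₗ[ℝ] X) (hL : L ∈ friends C A (wStar C A B)) (βb : ℝ[X])
    (h : Disjoint (wStar C A B) (LinearMap.ker C)) :
    wgStar C A B L hL βb ⊓ LinearMap.ker C = ⊥ ↔
      LinearMap.ker (aeval (zeroMap C A B L hL) βb) = ⊥ := by
  have key : ∀ x : (sStar C A B ⊓ LinearMap.ker C : Submodule ℝ X),
      (x : X) ∈ wgStar C A B L hL βb ↔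
        zeroEquiv C A B h x ∈ LinearMap.ker (aeval (zeroMap C A B L hL) βb) :=
    fun x => zeroSpace_mk_mem_badSpace_iff C A B L hL βb (zeroEquiv C A B h x)
  rw [Submodule.eq_bot_iff, Submodule.eq_bot_iff]
  constructor
  · intro H v hv
    obtain ⟨x, rfl⟩ := (zeroEquiv C A B h).surjective v
    have hx : x = 0 := Subtype.ext (H x ⟨(key x).2 hv, x.2.2⟩)
    rw [hx, map_zero]
  · rintro H x ⟨hx, hC⟩
    have hx' : x ∈ sStar C A B ⊓ LinearMap.ker C := ⟨wgStar_le_sStar C A B L hL βb hx, hC⟩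
    exact congrArg Subtype.val
      ((zeroEquiv C A B h).map_eq_zero_iff.1 (H _ ((key ⟨x, hx'⟩).1 hx)))

/-- If `A₁` agrees with `A` modulo `B` and `C A₁` kills whatever `A` sends into `B + Ker C`, then
the unobservable subspace of `(C, A₁)` is `S* ∩ Ker C`. -/
theorem unobs_eq_sStar_inf_ker {C : X →ₗ[ℝ] Y} {A A₁ : X →ₗ[ℝ] X} {B : Submodule ℝ X}
    (h : wStar C A B = B) (hsub : ∀ x, A₁ x - A x ∈ B)
    (hker : ∀ x, A x ∈ B ⊔ LinearMap.ker C → C (A₁ x) = 0) :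
    unobs (LinearMap.ker C) A₁ = sStar C A B ⊓ LinearMap.ker C := by
  apply le_antisymm
  · refine le_inf ?_ (unobs_le _ _)
    obtain ⟨⟨M, H, hMH⟩, hB⟩ := (sStar_isLeast C A B).1
    have hBK : sStar C A B ≤ LinearMap.ker (H ∘ₗ C) := by
      conv_lhs => rw [hMH]
      exact unobs_le _ _
    have hinv : ∀ x ∈ sStar C A B, inj C A M x ∈ sStar C A B := by
      rw [hMH]; exact map_mem_unobs _ _
    -- S* = ⟨Ker HC | A + MC⟩ is the largest (A + MC)-invariant subspace of Ker HC. Adding the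
    -- unobservable subspace keeps both properties: on it A + MC equals A, hence A₁ up to an element
    -- of B ⊆ S*.
    have hle : sStar C A B ⊔ unobs (LinearMap.ker C) A₁ ≤ sStar C A B := by
      conv_rhs => rw [hMH]
      refine le_unobs (sup_le hBK ((unobs_le _ _).trans (LinearMap.ker_le_ker_comp C H))) ?_
      intro x hx
      obtain ⟨s, hs, k, hk, rfl⟩ := Submodule.mem_sup.1 hx
      rw [map_add]
      refine Submodule.add_mem _ (Submodule.mem_sup_left (hinv s hs)) ?_
      have hk0 : C k = 0 := unobs_le _ _ hk
      have : inj C A M k = -(A₁ k - A k) + A₁ k := by simp [inj, hk0]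
      rw [this]
      exact Submodule.add_mem_sup (neg_mem (hB (hsub k))) (map_mem_unobs _ _ k hk)
    exact le_sup_right.trans hle
  · refine le_unobs inf_le_right fun x hx => ⟨?_, ?_⟩
    · rw [← sub_add_cancel (A₁ x) (A x)]
      exact Submodule.add_mem _ ((sStar_isLeast C A B).1.2 (hsub x))
        (sStar_isCAInvariant C A B x hx.1 hx.2)
    · refine hker x ?_
      have := sStar_le C A B (sStar_isCAInvariant C A B x hx.1 hx.2)
      rwa [h] at this

/-- On Ker C the maps A_L and A agree, and A₁ agrees with A modulo B = W*; so `zeroEquiv` conjugates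
one restriction into the other. -/
theorem charpoly_restrict_unobs_eq {C : X →ₗ[ℝ] Y} {A A₁ : X →ₗ[ℝ] X} {B : Submodule ℝ X}
    (hB : Disjoint B (LinearMap.ker C)) (hsub : ∀ x, A₁ x - A x ∈ B)
    (hker : ∀ x, A x ∈ B ⊔ LinearMap.ker C → C (A₁ x) = 0)
    (L : Y →ₗ[ℝ] X) (hL : L ∈ friends C A (wStar C A B)) :
    (A₁.restrict (map_mem_unobs (LinearMap.ker C) A₁)).charpoly =
      (zeroMap C A B L hL).charpoly := by
  have hW := wStar_eq_self (A := A) hB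
  have hN := unobs_eq_sStar_inf_ker hW hsub hker
  let e := (LinearEquiv.ofEq _ _ hN).trans (zeroEquiv C A B (hW.symm ▸ hB))
  rw [← e.charpoly_conj]
  congr 1
  ext v
  obtain ⟨x, rfl⟩ := e.surjective v
  rw [LinearEquiv.conj_apply_apply, e.symm_apply_apply]
  change (wStar C A B).mkQ (A₁ x) = (wStar C A B).mkQ (inj C A L x)
  have hx : C (x : X) = 0 := unobs_le _ _ x.2
  have hmem : A₁ (x : X) - A x ∈ wStar C A B := hW.symm ▸ hsub x
  rw [← sub_eq_zero, ← map_sub, ← LinearMap.mem_ker, Submodule.ker_mkQ]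
  simpa [inj, hx] using hmem

end Geometric

/-! ### The rank condition and the projected matrix -/

section Rank

open Matrix

variable {m n k : Type*} [Fintype n] [Fintype k]

/-- By rank–nullity for M restricted to Im N, the rank drops by dim (Im N ∩ Ker M). -/
theorem rank_mul_eq_rank_right_iff_disjoint (M : Matrix m n ℝ) (N : Matrix n k ℝ) :
    (M * N).rank = N.rank ↔
      Disjoint (LinearMap.range N.mulVecLin) (LinearMap.ker M.mulVecLin) := by
  have hrank : (M * N).rank =
      finrank ℝ (LinearMap.range (M.mulVecLin.domRestrict (LinearMap.range N.mulVecLin))) := by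
    rw [Matrix.rank, Matrix.mulVecLin_mul, LinearMap.range_comp, LinearMap.range_domRestrict]
  have hnull := LinearMap.finrank_range_add_finrank_ker
    (M.mulVecLin.domRestrict (LinearMap.range N.mulVecLin))
  have hN : N.rank = finrank ℝ (LinearMap.range N.mulVecLin) := rfl
  rw [LinearMap.disjoint_ker, hrank, hN, ← hnull, left_eq_add, Submodule.finrank_eq_zero,
    LinearMap.ker_eq_bot']
  simp

variable {l : Type*} [Fintype m] [Fintype l] [DecidableEq n]

theorem projected_mulVec (M : Matrix n k ℝ) (G : Matrix k m ℝ) (N : Matrix m n ℝ)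
    (A : Matrix n l ℝ) (x : l → ℝ) :
    ((1 - M * G * N) * A) *ᵥ x = A *ᵥ x - M *ᵥ (G *ᵥ (N *ᵥ (A *ᵥ x))) := by
  simp only [Matrix.sub_mul, Matrix.one_mul, Matrix.sub_mulVec, Matrix.mulVec_mulVec,
    Matrix.mul_assoc]

theorem projected_sub_mem_range (M : Matrix n k ℝ) (G : Matrix k m ℝ) (N : Matrix m n ℝ)
    (A : Matrix n l ℝ) (x : l → ℝ) :
    ((1 - M * G * N) * A).mulVecLin x - A.mulVecLin x ∈ LinearMap.range M.mulVecLin := by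
  refine ⟨-(G *ᵥ (N *ᵥ (A *ᵥ x))), ?_⟩
  simp only [Matrix.mulVecLin_apply, projected_mulVec, Matrix.mulVec_neg]
  abel

/-- If A x = M u + v with N v = 0, the value is NM u - (NM) G (NM) u. Only the first Penrose
equation matters, so any generalized inverse with that property would do. -/
theorem mulVec_projected_eq_zero {M : Matrix n k ℝ} {G : Matrix k m ℝ} {N : Matrix m n ℝ}
    (hG : N * M * G * (N * M) = N * M) (A : Matrix n l ℝ) {x : l → ℝ}
    (hx : A.mulVecLin x ∈ LinearMap.range M.mulVecLin ⊔ LinearMap.ker N.mulVecLin) :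
    N.mulVecLin (((1 - M * G * N) * A).mulVecLin x) = 0 := by
  obtain ⟨_, ⟨u, rfl⟩, v, hv, huv⟩ := Submodule.mem_sup.1 hx
  rw [LinearMap.mem_ker] at hv
  simp only [Matrix.mulVecLin_apply] at hv huv ⊢
  have hNA : N *ᵥ (A *ᵥ x) = (N * M) *ᵥ u := by
    rw [← huv, Matrix.mulVec_add, hv, add_zero, Matrix.mulVec_mulVec]
  rw [projected_mulVec, Matrix.mulVec_sub, hNA, Matrix.mulVec_mulVec, Matrix.mulVec_mulVec,
    Matrix.mulVec_mulVec, hG, sub_self]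

end Rank

end UnknownInput

/-! ### The equivalence -/

theorem proposition1 {n p q : ℕ}
    (A : Matrix (Fin n) (Fin n) ℝ) (Bbar : Matrix (Fin n) (Fin q) ℝ)
    (C : Matrix (Fin p) (Fin n) ℝ)
    (Cg Cb : Set ℂ) (hpart : UnknownInput.IsSymmetricPartition Cg Cb)
    (L : (Fin p → ℝ) →ₗ[ℝ] (Fin n → ℝ))
    (hL : L ∈ UnknownInput.friends C.mulVecLin A.mulVecLin
      (UnknownInput.wStar C.mulVecLin A.mulVecLin (LinearMap.range Bbar.mulVecLin)))
    (βg βb : Polynomial ℝ)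
    (hβ : UnknownInput.IsGoodBadFactorization Cg Cb
      (minpoly ℝ (UnknownInput.zeroMap C.mulVecLin A.mulVecLin (LinearMap.range Bbar.mulVecLin) L hL))
      βg βb) :
    ((C * Bbar).rank = Bbar.rank ∧
      UnknownInput.IsDetectable Cg C.mulVecLin
        ((1 - Bbar * UnknownInput.pinv (C * Bbar) * C) * A).mulVecLin) ↔
    UnknownInput.wgStar C.mulVecLin A.mulVecLin (LinearMap.range Bbar.mulVecLin) L hL βb ⊓
      LinearMap.ker C.mulVecLin = ⊥ := by 
  rw [UnknownInput.rank_mul_eq_rank_right_iff_disjoint]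
  -- Granted (i), both sides say that the eigenvalues of A_L | S*/W* are good.
  have hdetect (hB : Disjoint (LinearMap.range Bbar.mulVecLin) (LinearMap.ker C.mulVecLin)) :
      UnknownInput.IsDetectable Cg C.mulVecLin
          ((1 - Bbar * UnknownInput.pinv (C * Bbar) * C) * A).mulVecLin ↔
        UnknownInput.wgStar C.mulVecLin A.mulVecLin (LinearMap.range Bbar.mulVecLin) L hL βb ⊓
          LinearMap.ker C.mulVecLin = ⊥ := by
    rw [UnknownInput.wgStar_inf_ker_eq_bot_iff _ _ _ _ _ _
        ((UnknownInput.wStar_eq_self hB).symm ▸ hB),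
      UnknownInput.ker_aeval_bad_eq_bot_iff hpart hβ, UnknownInput.IsDetectable,
      UnknownInput.charpoly_restrict_unobs_eq hB
        (UnknownInput.projected_sub_mem_range _ _ _ _)
        (fun _ => UnknownInput.mulVec_projected_eq_zero
          (UnknownInput.pinv_spec (C * Bbar)).mul_mul_left A) L hL]
  constructor
  · rintro ⟨hB, hd⟩
    exact (hdetect hB).1 hd
  · intro h
    -- Im B̄ ⊆ W* ⊆ W_g* yields the rank condition.
    have hB : Disjoint (LinearMap.range Bbar.mulVecLin) (LinearMap.ker C.mulVecLin) :=
      (disjoint_iff.2 h).mono_left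
        ((UnknownInput.wStar_isLeast _ _ _).1.2.trans
          (UnknownInput.wStar_le_wgStar _ _ _ L hL βb))
    exact ⟨hB, (hdetect hB).2 h⟩
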